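/- Let $K$ be a field of positive characteristic $p$ and let $L$ be a Lie algebra over $K$ (of arbitrary dimension, not necessarily restricted). Let $S(L)$ be the symmetric algebra of the vector space $L$, with the Poisson bracket that extends the Lie bracket of $L$ by bilinearity and the Leibniz rule $\{ab,c\}=a\{b,c\}+b\{a,c\}$, and let $\mathbf{s}(L)=S(L)/(v^p \mid v\in L)$ be the truncated symmetric Poisson algebra with the induced bracket. For a Poisson algebra $R$ over $K$ put $\delta_0(R)=R$, $\delta_{n+1}(R)=\{\delta_n(R),\delta_n(R)\}$ (the linear span of the brackets) and $\tilde\delta_0(R)=R$, $\tilde\delta_{n+1}(R)=\{\tilde\delta_n(R),\tilde\delta_n(R)\}\cdot R$ (the ideal of the commutative algebra $R$ generated by the brackets). The algebra $R$ is called solvable if $\delta_s(R)=0$ for some $s$, and strongly solvable if $\tilde\delta_s(R)=0$ for some $s$. Theorem. If $p\ge 3$, the following conditions are equivalent: (1) $\mathbf{s}(L)$ is strongly solvable; (2) $\mathbf{s}(L)$ is solvable; (3) $L$ is solvable and $\dim_K L^2<\infty$, where $L^2=[L,L]$. If $p=2$, conditions (1) and (3) are equivalent. -/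

import Mathlib

/-- A Poisson algebra over `K`: a commutative associative unital `K`-algebra with a second,
`K`-bilinear operation which is a Lie bracket and is related to the product by the Leibniz rule. -/
class PoissonAlgebra (K A : Type*) [CommRing K] [CommRing A] [Algebra K A] where
  /-- The Poisson bracket `{a, b}`. -/
  bracket : A →ₗ[K] A →ₗ[K] A
  bracket_self : ∀ a : A, bracket a a = 0
  jacobi : ∀ a b c : A,
    bracket a (bracket b c) + bracket b (bracket c a) + bracket c (bracket a b) = 0
  leibniz : ∀ a b c : A, bracket (a * b) c = a * bracket b c + b * bracket a c

namespace PoissonAlgebra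

variable (K A : Type*) [CommRing K] [CommRing A] [Algebra K A] [PoissonAlgebra K A]

/-- The derived series `δ₀ = A`, `δₙ₊₁ = {δₙ, δₙ}` (the linear span of all brackets of two
elements of `δₙ`). -/
def derivedSeries : ℕ → Submodule K A
  | 0 => ⊤
  | n + 1 => Submodule.span K
      {c | ∃ a ∈ derivedSeries n, ∃ b ∈ derivedSeries n, c = bracket (K := K) a b}

/-- The upper derived series `δ̃₀ = A`, `δ̃ₙ₊₁ = {δ̃ₙ, δ̃ₙ} · A` (the ideal of the commutative
algebra `A` generated by all brackets of two elements of `δ̃ₙ`). -/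
def upperDerivedSeries : ℕ → Ideal A
  | 0 => ⊤
  | n + 1 => Ideal.span
      {c | ∃ a ∈ upperDerivedSeries n, ∃ b ∈ upperDerivedSeries n, c = bracket (K := K) a b}

/-- A Poisson algebra is solvable if its derived series reaches zero. -/
def IsSolvable : Prop := ∃ s : ℕ, derivedSeries K A s = ⊥

/-- A Poisson algebra is strongly solvable if its upper derived series reaches zero. -/
def IsStronglySolvable : Prop := ∃ s : ℕ, upperDerivedSeries K A s = ⊥

end PoissonAlgebra

namespace SymmetricAlgebra

section Derivations

variable {K M : Type*} [CommRing K] [AddCommGroup M] [Module K M]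

/-- The algebra map `a ↦ a + ε D(a)` into the dual numbers over the symmetric algebra which is
determined by the values `f` of `D` on generators. -/
noncomputable def dualLift (f : M →ₗ[K] SymmetricAlgebra K M) :
    SymmetricAlgebra K M →ₐ[K] TrivSqZeroExt (SymmetricAlgebra K M) (SymmetricAlgebra K M) :=
  lift ((TrivSqZeroExt.inlAlgHom K (SymmetricAlgebra K M) (SymmetricAlgebra K M)).toLinearMap ∘ₗ
      ι K M + (TrivSqZeroExt.inrHom (SymmetricAlgebra K M) (SymmetricAlgebra K M)).restrictScalars K
      ∘ₗ f)

theorem dualLift_ι (f : M →ₗ[K] SymmetricAlgebra K M) (x : M) :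
    dualLift f (ι K M x) = TrivSqZeroExt.inl (ι K M x) + TrivSqZeroExt.inr (f x) := by
  simp [dualLift]

theorem fst_dualLift (f : M →ₗ[K] SymmetricAlgebra K M) (a : SymmetricAlgebra K M) :
    (dualLift f a).fst = a := by
  have h : (TrivSqZeroExt.fstHom K (SymmetricAlgebra K M) (SymmetricAlgebra K M)).comp
      (dualLift f) = AlgHom.id K _ := by
    apply algHom_ext
    ext x
    simp [dualLift_ι]
  exact congr($h a)

/-- The unique derivation of the symmetric algebra with prescribed values on generators. -/
noncomputable def derivation (f : M →ₗ[K] SymmetricAlgebra K M) :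
    Derivation K (SymmetricAlgebra K M) (SymmetricAlgebra K M) :=
  Derivation.mk'
    ((TrivSqZeroExt.sndHom (SymmetricAlgebra K M) (SymmetricAlgebra K M)).restrictScalars K ∘ₗ
      (dualLift f).toLinearMap)
    (by intro a b; simp [fst_dualLift, mul_comm])

theorem derivation_ι (f : M →ₗ[K] SymmetricAlgebra K M) (x : M) :
    derivation f (ι K M x) = f x := by
  simp [derivation, dualLift_ι]

theorem derivation_ext {D E : Derivation K (SymmetricAlgebra K M) (SymmetricAlgebra K M)}
    (h : ∀ x, D (ι K M x) = E (ι K M x)) : D = E := by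
  ext a
  induction a using SymmetricAlgebra.induction with
  | algebraMap r => simp
  | ι x => exact h x
  | mul a b ha hb => simp [ha, hb]
  | add a b ha hb => simp [ha, hb]

/-- `derivation` as a linear map. -/
noncomputable def derivationₗ : (M →ₗ[K] SymmetricAlgebra K M) →ₗ[K]
    Derivation K (SymmetricAlgebra K M) (SymmetricAlgebra K M) where
  toFun := derivation
  map_add' f g := derivation_ext fun x => by simp [derivation_ι]
  map_smul' c f := derivation_ext fun x => by simp [derivation_ι]

end Derivations

section Poisson

variable (K L : Type*) [CommRing K] [LieRing L] [LieAlgebra K L]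

/-- For `x` in `L`, the derivation `{x, ·}` of the symmetric algebra that sends each generator `y`
in `L` to `[x, y]`. -/
noncomputable def adDerivation :
    L →ₗ[K] Derivation K (SymmetricAlgebra K L) (SymmetricAlgebra K L) where
  toFun x := derivation (ι K L ∘ₗ (LieAlgebra.ad K L x : L →ₗ[K] L))
  map_add' x y := derivation_ext fun z => by simp [derivation_ι]
  map_smul' c x := derivation_ext fun z => by simp [derivation_ι]

theorem adDerivation_ι (x y : L) : adDerivation K L x (ι K L y) = ι K L ⁅x, y⁆ := by
  simp [adDerivation, derivation_ι]

/-- The Poisson bracket of the symmetric algebra of a Lie algebra: for fixed `b`, the map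
`{·, b}` is the derivation that sends each generator `x` in `L` to `{x, b}`. -/
noncomputable def poissonBracket :
    SymmetricAlgebra K L →ₗ[K] SymmetricAlgebra K L →ₗ[K] SymmetricAlgebra K L where
  toFun a :=
    { toFun := fun b => derivation
        { toFun := fun x => adDerivation K L x b
          map_add' := fun x y => by simp
          map_smul' := fun c x => by simp } a
      map_add' := fun b c => by
        rw [← Derivation.add_apply]
        congr 1
        exact derivation_ext fun x => by simp [derivation_ι]
      map_smul' := fun r b => by
        rw [RingHom.id_apply, ← Derivation.smul_apply]
        congr 1
        exact derivation_ext fun x => by simp [derivation_ι] }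
  map_add' a b := by ext c; simp
  map_smul' r a := by ext c; simp

variable {K L}

theorem poissonBracket_ι_left (x : L) (b : SymmetricAlgebra K L) :
    poissonBracket K L (ι K L x) b = adDerivation K L x b := by
  simp [poissonBracket, derivation_ι]

theorem poissonBracket_ι_ι (x y : L) :
    poissonBracket K L (ι K L x) (ι K L y) = ι K L ⁅x, y⁆ := by
  rw [poissonBracket_ι_left, adDerivation_ι]

theorem poissonBracket_mul_left (a b c : SymmetricAlgebra K L) :
    poissonBracket K L (a * b) c =
      a * poissonBracket K L b c + b * poissonBracket K L a c := by
  simp [poissonBracket]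

theorem poissonBracket_algebraMap_left (r : K) (b : SymmetricAlgebra K L) :
    poissonBracket K L (algebraMap K _ r) b = 0 := by
  simp [poissonBracket]

theorem poissonBracket_algebraMap_right (a : SymmetricAlgebra K L) (r : K) :
    poissonBracket K L a (algebraMap K _ r) = 0 := by
  induction a using SymmetricAlgebra.induction with
  | algebraMap s => simp [poissonBracket_algebraMap_left]
  | ι x => simp [poissonBracket_ι_left]
  | mul a b ha hb => simp [poissonBracket_mul_left, ha, hb]
  | add a b ha hb => simp [ha, hb]

theorem poissonBracket_mul_right (a b c : SymmetricAlgebra K L) :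
    poissonBracket K L a (b * c) =
      b * poissonBracket K L a c + c * poissonBracket K L a b := by
  induction a using SymmetricAlgebra.induction with
  | algebraMap s => simp [poissonBracket_algebraMap_left]
  | ι x => simp [poissonBracket_ι_left]
  | mul a a' ha hb => rw [poissonBracket_mul_left, ha, hb, poissonBracket_mul_left,
      poissonBracket_mul_left]; ring
  | add a a' ha hb => rw [map_add, LinearMap.add_apply, ha, hb, LinearMap.add_apply,
      LinearMap.add_apply]; ring

theorem poissonBracket_skew (a b : SymmetricAlgebra K L) :
    poissonBracket K L a b = -poissonBracket K L b a := by
  induction a using SymmetricAlgebra.induction with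
  | algebraMap s => simp [poissonBracket_algebraMap_left, poissonBracket_algebraMap_right]
  | ι x =>
    induction b using SymmetricAlgebra.induction with
    | algebraMap s => simp [poissonBracket_algebraMap_left, poissonBracket_algebraMap_right]
    | ι y => rw [poissonBracket_ι_ι, poissonBracket_ι_ι, ← map_neg, lie_skew]
    | mul b c hb hc => rw [poissonBracket_mul_left, poissonBracket_mul_right, hb, hc]; ring
    | add b c hb hc => simp only [map_add, LinearMap.add_apply, hb, hc]; ring
  | mul a a' ha hb => rw [poissonBracket_mul_left, poissonBracket_mul_right, ha, hb]; ring
  | add a a' ha hb => simp only [map_add, LinearMap.add_apply, ha, hb]; ring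

theorem poissonBracket_self (a : SymmetricAlgebra K L) : poissonBracket K L a a = 0 := by
  induction a using SymmetricAlgebra.induction with
  | algebraMap s => simp [poissonBracket_algebraMap_left]
  | ι x => simp [poissonBracket_ι_ι]
  | mul a b ha hb =>
    simp only [poissonBracket_mul_left, poissonBracket_mul_right, ha, hb]
    rw [poissonBracket_skew b a]; ring
  | add a b ha hb =>
    simp only [map_add, LinearMap.add_apply, ha, hb]
    rw [poissonBracket_skew b a]; ring

theorem poissonBracket_jacobi (a b c : SymmetricAlgebra K L) :
    poissonBracket K L a (poissonBracket K L b c) + poissonBracket K L b (poissonBracket K L c a) +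
      poissonBracket K L c (poissonBracket K L a b) = 0 := by
  induction a using SymmetricAlgebra.induction with
  | algebraMap s => simp [poissonBracket_algebraMap_left, poissonBracket_algebraMap_right]
  | ι x =>
    induction b using SymmetricAlgebra.induction with
    | algebraMap s => simp [poissonBracket_algebraMap_left, poissonBracket_algebraMap_right]
    | ι y =>
      induction c using SymmetricAlgebra.induction with
      | algebraMap s => simp [poissonBracket_algebraMap_left, poissonBracket_algebraMap_right]
      | ι z => simp only [poissonBracket_ι_ι, ← map_add, lie_jacobi, map_zero]
      | mul c c' h h' =>
        simp only [poissonBracket_mul_left, poissonBracket_mul_right, map_add] at h h' ⊢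
        have e1 := poissonBracket_skew c (ι K L x)
        have e2 := poissonBracket_skew c' (ι K L x)
        rw [e1] at h ⊢
        rw [e2] at h' ⊢
        linear_combination c * h' + c' * h
      | add c c' h h' =>
        simp only [map_add, LinearMap.add_apply] at h h' ⊢
        linear_combination h + h'
    | mul b b' h h' =>
      simp only [poissonBracket_mul_left, poissonBracket_mul_right, map_add] at h h' ⊢
      have e1 := poissonBracket_skew (ι K L x) b
      have e2 := poissonBracket_skew (ι K L x) b'
      have e3 := poissonBracket_skew c b
      have e4 := poissonBracket_skew c b'
      rw [e1] at h ⊢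
      rw [e2] at h' ⊢
      rw [e3, e4]
      linear_combination b * h' + b' * h
    | add b b' h h' =>
      simp only [map_add, LinearMap.add_apply] at h h' ⊢
      linear_combination h + h'
  | mul a a' h h' =>
    simp only [poissonBracket_mul_left, poissonBracket_mul_right, map_add] at h h' ⊢
    have e1 := poissonBracket_skew c a
    have e2 := poissonBracket_skew c a'
    have e3 := poissonBracket_skew b a
    have e4 := poissonBracket_skew b a'
    rw [e1] at h ⊢
    rw [e2] at h' ⊢
    rw [e3, e4]
    linear_combination a * h' + a' * h
  | add a a' h h' =>
    simp only [map_add, LinearMap.add_apply] at h h' ⊢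
    linear_combination h + h'

/-- The symmetric Poisson algebra `S(L)` of a Lie algebra `L`. -/
noncomputable instance instPoissonAlgebra : PoissonAlgebra K (SymmetricAlgebra K L) where
  bracket := poissonBracket K L
  bracket_self := poissonBracket_self
  jacobi := poissonBracket_jacobi
  leibniz := poissonBracket_mul_left

end Poisson

end SymmetricAlgebra

section Truncated

variable (K L : Type*) [CommRing K] [LieRing L] [LieAlgebra K L] (p : ℕ)

/-- The ideal of `S(L)` generated by the powers `v ^ p`, where `v` runs over `L`. -/
def truncationIdeal : Ideal (SymmetricAlgebra K L) :=
  Ideal.span (Set.range fun v : L => SymmetricAlgebra.ι K L v ^ p)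

/-- The truncated symmetric algebra `s(L) = S(L) / (v ^ p | v ∈ L)`. -/
abbrev TruncatedSymmetricAlgebra : Type _ := SymmetricAlgebra K L ⧸ truncationIdeal K L p

namespace TruncatedSymmetricAlgebra

variable {K L} [CharP K p]

theorem bracket_pow (v : L) (u : SymmetricAlgebra K L) :
    SymmetricAlgebra.poissonBracket K L (SymmetricAlgebra.ι K L v ^ p) u = 0 := by
  have h : ∀ n : ℕ, SymmetricAlgebra.poissonBracket K L (SymmetricAlgebra.ι K L v ^ n) u =
      n * (SymmetricAlgebra.ι K L v ^ (n - 1) *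
        SymmetricAlgebra.poissonBracket K L (SymmetricAlgebra.ι K L v) u) := by
    intro n
    induction n with
    | zero =>
      have := SymmetricAlgebra.poissonBracket_algebraMap_left (1 : K) u
      simpa using this
    | succ n ih =>
      rw [pow_succ, SymmetricAlgebra.poissonBracket_mul_left, ih]
      rcases n with _ | n
      · simp
      · simp only [Nat.add_sub_cancel, pow_succ]
        push_cast
        ring
  have hp : (p : SymmetricAlgebra K L) = 0 := by
    rw [← map_natCast (algebraMap K (SymmetricAlgebra K L)), CharP.cast_eq_zero, map_zero]
  rw [h, hp, zero_mul]

theorem bracket_mem_left {a : SymmetricAlgebra K L} (ha : a ∈ truncationIdeal K L p)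
    (u : SymmetricAlgebra K L) :
    SymmetricAlgebra.poissonBracket K L a u ∈ truncationIdeal K L p := by
  induction ha using Submodule.span_induction with
  | mem x hx =>
    obtain ⟨v, rfl⟩ := hx
    simp [bracket_pow]
  | zero => simp
  | add x y _ _ hx hy => simpa using add_mem hx hy
  | smul r x hx h =>
    rw [smul_eq_mul, SymmetricAlgebra.poissonBracket_mul_left]
    exact add_mem (Ideal.mul_mem_left _ _ h) (Ideal.mul_mem_right _ _ hx)

theorem mk_bracket_eq {a a' b b' : SymmetricAlgebra K L}
    (ha : Ideal.Quotient.mk (truncationIdeal K L p) a = Ideal.Quotient.mk _ a')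
    (hb : Ideal.Quotient.mk (truncationIdeal K L p) b = Ideal.Quotient.mk _ b') :
    Ideal.Quotient.mk (truncationIdeal K L p) (SymmetricAlgebra.poissonBracket K L a b) =
      Ideal.Quotient.mk _ (SymmetricAlgebra.poissonBracket K L a' b') := by
  rw [Ideal.Quotient.eq] at ha hb ⊢
  have h : SymmetricAlgebra.poissonBracket K L a b - SymmetricAlgebra.poissonBracket K L a' b' =
      SymmetricAlgebra.poissonBracket K L (a - a') b -
        SymmetricAlgebra.poissonBracket K L (b - b') a' := by
    rw [SymmetricAlgebra.poissonBracket_skew (b - b') a']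
    simp only [map_sub, LinearMap.sub_apply]
    ring
  rw [h]
  exact sub_mem (bracket_mem_left p ha b) (bracket_mem_left p hb a')

/-- The Poisson bracket of `s(L)`, induced by that of `S(L)`. -/
noncomputable def bracket : TruncatedSymmetricAlgebra K L p →ₗ[K]
    TruncatedSymmetricAlgebra K L p →ₗ[K] TruncatedSymmetricAlgebra K L p :=
  LinearMap.mk₂ K
    (fun a b => Quotient.liftOn₂' a b
      (fun a b => Ideal.Quotient.mk (truncationIdeal K L p)
        (SymmetricAlgebra.poissonBracket K L a b))
      (fun _ _ _ _ ha hb => mk_bracket_eq p (Quotient.sound' ha) (Quotient.sound' hb)))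
    (fun a a' b => by
      obtain ⟨a, rfl⟩ := Ideal.Quotient.mk_surjective a
      obtain ⟨a', rfl⟩ := Ideal.Quotient.mk_surjective a'
      obtain ⟨b, rfl⟩ := Ideal.Quotient.mk_surjective b
      exact congrArg (Ideal.Quotient.mk (truncationIdeal K L p))
        (LinearMap.map_add₂ (SymmetricAlgebra.poissonBracket K L) a a' b))
    (fun r a b => by
      obtain ⟨a, rfl⟩ := Ideal.Quotient.mk_surjective a
      obtain ⟨b, rfl⟩ := Ideal.Quotient.mk_surjective b
      exact congrArg (Ideal.Quotient.mk (truncationIdeal K L p))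
        (LinearMap.map_smul₂ (SymmetricAlgebra.poissonBracket K L) r a b))
    (fun a b b' => by
      obtain ⟨a, rfl⟩ := Ideal.Quotient.mk_surjective a
      obtain ⟨b, rfl⟩ := Ideal.Quotient.mk_surjective b
      obtain ⟨b', rfl⟩ := Ideal.Quotient.mk_surjective b'
      exact congrArg (Ideal.Quotient.mk (truncationIdeal K L p))
        (map_add (SymmetricAlgebra.poissonBracket K L a) b b'))
    (fun r a b => by
      obtain ⟨a, rfl⟩ := Ideal.Quotient.mk_surjective a
      obtain ⟨b, rfl⟩ := Ideal.Quotient.mk_surjective b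
      exact congrArg (Ideal.Quotient.mk (truncationIdeal K L p))
        (map_smul (SymmetricAlgebra.poissonBracket K L a) r b))

theorem bracket_mk (a b : SymmetricAlgebra K L) :
    bracket p (Ideal.Quotient.mk (truncationIdeal K L p) a)
      (Ideal.Quotient.mk (truncationIdeal K L p) b) =
      Ideal.Quotient.mk (truncationIdeal K L p) (SymmetricAlgebra.poissonBracket K L a b) :=
  rfl

/-- The truncated symmetric Poisson algebra `s(L)` of a Lie algebra in characteristic `p`. -/
noncomputable instance instPoissonAlgebra :
    PoissonAlgebra K (TruncatedSymmetricAlgebra K L p) where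
  bracket := bracket p
  bracket_self a := by
    obtain ⟨a, rfl⟩ := Ideal.Quotient.mk_surjective a
    rw [bracket_mk, SymmetricAlgebra.poissonBracket_self, map_zero]
  jacobi a b c := by
    obtain ⟨a, rfl⟩ := Ideal.Quotient.mk_surjective a
    obtain ⟨b, rfl⟩ := Ideal.Quotient.mk_surjective b
    obtain ⟨c, rfl⟩ := Ideal.Quotient.mk_surjective c
    simp only [bracket_mk, ← map_add, SymmetricAlgebra.poissonBracket_jacobi, map_zero]
  leibniz a b c := by
    obtain ⟨a, rfl⟩ := Ideal.Quotient.mk_surjective a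
    obtain ⟨b, rfl⟩ := Ideal.Quotient.mk_surjective b
    obtain ⟨c, rfl⟩ := Ideal.Quotient.mk_surjective c
    rw [← map_mul, bracket_mk, bracket_mk, bracket_mk, ← map_mul, ← map_mul, ← map_add,
      SymmetricAlgebra.poissonBracket_mul_left]

end TruncatedSymmetricAlgebra

end Truncated

/-!
Let `C` be the ideal of `s(L)` generated by all brackets; it is generated by `L²`. The ideal
generated by a subspace of `L` is nilpotent exactly when the subspace is finite-dimensional: its
generators have vanishing `p`-th powers, while a product of linearly independent elements of `L` is
not even a combination of their squares. Since `ab{x, y}` is a combination of brackets of multiples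
of `a` with multiples of `b`, the upper derived series contains powers of `C`, so strong solvability
makes `C` nilpotent. Conversely, modulo `C²` the upper derived series of `s(L)` is generated by the
derived series of `L`, and once it is contained in `C²` it descends through the powers of `C`.

Let now `p ≥ 3` and `x ∈ L`. From `{xa, xb} = x(a{x, b} - b{x, a}) + x²{a, b}` and the polarization
`2ab{x, y} = (a{x, by} - by{x, a}) + (b{x, ay} - ay{x, b})` it follows by induction that for every
`a` in the power with exponent `2ⁿ - 1` of the ideal generated by `{x, s(L)}` there is an element
`x(a + xc)` in `δₙ`. If `δₙ = 0`, then `xa` is divisible by `x²`, which bounds the rank of `ad x` by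
`2ⁿ - 1`. Such a bound, uniform in `x`, makes `L²` finite-dimensional: this is an analogue of
B. H. Neumann's theorem that a group with conjugacy classes of bounded size has a finite commutator
subgroup.
-/

theorem pow_two_pow_succ_sub_one {M : Type*} [Monoid M] (a : M) (n : ℕ) :
    a ^ (2 ^ (n + 1) - 1) = a ^ (2 ^ n - 1) * a ^ (2 ^ n - 1) * a := by
  rw [← pow_add, ← pow_succ]
  congr 1
  have := Nat.one_le_two_pow (n := n)
  omega

theorem derivation_apply_mem_of_adjoin_eq_top {K A : Type*} [CommSemiring K] [CommSemiring A]
    [Algebra K A] (D : Derivation K A A) {S : Set A} (hS : Algebra.adjoin K S = ⊤) {J : Ideal A}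
    (hD : ∀ s ∈ S, D s ∈ J) (a : A) : D a ∈ J := by
  have ha : a ∈ Algebra.adjoin K S := hS ▸ Algebra.mem_top
  induction ha using Algebra.adjoin_induction with
  | mem s hs => exact hD s hs
  | algebraMap r => simp
  | add a b _ _ ha hb => simpa only [map_add] using add_mem ha hb
  | mul a b _ _ ha hb =>
    simpa only [Derivation.leibniz, smul_eq_mul] using
      add_mem (J.mul_mem_left a hb) (J.mul_mem_left b ha)

namespace PoissonAlgebra

section BracketIdeal

variable {K A : Type*} [CommRing K] [CommRing A] [Algebra K A] [PoissonAlgebra K A]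

theorem bracket_skew (a b : A) : bracket (K := K) a b = -bracket (K := K) b a := by
  have h := bracket_self (K := K) (a + b)
  simp only [map_add, LinearMap.add_apply, bracket_self, zero_add, add_zero] at h
  exact eq_neg_of_add_eq_zero_right h

theorem leibniz_right (a b c : A) :
    bracket (K := K) a (b * c) = b * bracket (K := K) a c + c * bracket (K := K) a b := by
  rw [bracket_skew, leibniz, bracket_skew a c, bracket_skew a b]
  ring

variable (K) in
/-- The Hamiltonian derivation `{a, ·}`. -/
def hamiltonian (a : A) : Derivation K A A :=
  Derivation.mk' (bracket a) fun b c => leibniz_right a b c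

theorem hamiltonian_apply (a b : A) : hamiltonian K a b = bracket (K := K) a b :=
  rfl

variable (K) in
/-- The ideal `{I, J} · A` generated by the brackets of elements of `I` with elements of `J`; the
terms of the upper derived series are iterates of `I ↦ {I, I} · A`. -/
def bracketIdeal (I J : Ideal A) : Ideal A :=
  Ideal.span {c | ∃ a ∈ I, ∃ b ∈ J, c = bracket (K := K) a b}

theorem bracket_mem_bracketIdeal {I J : Ideal A} {a b : A} (ha : a ∈ I) (hb : b ∈ J) :
    bracket (K := K) a b ∈ bracketIdeal K I J :=
  Ideal.subset_span ⟨a, ha, b, hb, rfl⟩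

theorem bracketIdeal_le {I J N : Ideal A} :
    bracketIdeal K I J ≤ N ↔ ∀ a ∈ I, ∀ b ∈ J, bracket (K := K) a b ∈ N := by
  refine Ideal.span_le.trans ⟨fun h a ha b hb => h ⟨a, ha, b, hb, rfl⟩, ?_⟩
  rintro h _ ⟨a, ha, b, hb, rfl⟩
  exact h a ha b hb

theorem bracketIdeal_mono {I I' J J' : Ideal A} (hI : I ≤ I') (hJ : J ≤ J') :
    bracketIdeal K I J ≤ bracketIdeal K I' J' :=
  bracketIdeal_le.2 fun _ ha _ hb => bracket_mem_bracketIdeal (hI ha) (hJ hb)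

theorem bracketIdeal_comm (I J : Ideal A) : bracketIdeal K I J = bracketIdeal K J I := by
  have le_swap (I J : Ideal A) : bracketIdeal K I J ≤ bracketIdeal K J I :=
    bracketIdeal_le.2 fun a ha b hb =>
      bracket_skew (K := K) a b ▸ neg_mem (bracket_mem_bracketIdeal hb ha)
  exact (le_swap I J).antisymm (le_swap J I)

theorem bracketIdeal_sup_self_le (I J : Ideal A) :
    bracketIdeal K (I ⊔ J) (I ⊔ J) ≤ bracketIdeal K I I ⊔ bracketIdeal K J ⊤ := by
  refine bracketIdeal_le.2 fun a ha b hb => ?_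
  obtain ⟨a₁, ha₁, a₂, ha₂, rfl⟩ := Submodule.mem_sup.1 ha
  obtain ⟨b₁, hb₁, b₂, hb₂, rfl⟩ := Submodule.mem_sup.1 hb
  have expand : bracket (K := K) (a₁ + a₂) (b₁ + b₂) =
      bracket (K := K) a₁ b₁ + (bracket (K := K) a₂ (b₁ + b₂) - bracket (K := K) b₂ a₁) := by
    simp only [map_add, LinearMap.add_apply, bracket_skew b₂ a₁]
    ring
  rw [expand]
  exact Submodule.add_mem_sup (bracket_mem_bracketIdeal ha₁ hb₁)
    (sub_mem (bracket_mem_bracketIdeal ha₂ trivial) (bracket_mem_bracketIdeal hb₂ trivial))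

theorem bracketIdeal_mul_le (I J N : Ideal A) :
    bracketIdeal K (I * J) N ≤ I * bracketIdeal K J N ⊔ J * bracketIdeal K I N := by
  refine bracketIdeal_le.2 fun c hc d hd => ?_
  induction hc using Submodule.mul_induction_on' with
  | mem_mul_mem a ha b hb =>
    rw [leibniz]
    exact Submodule.add_mem_sup (Ideal.mul_mem_mul ha (bracket_mem_bracketIdeal hb hd))
      (Ideal.mul_mem_mul hb (bracket_mem_bracketIdeal ha hd))
  | add a _ b _ ha hb =>
    rw [map_add, LinearMap.add_apply]
    exact add_mem ha hb

theorem bracketIdeal_pow_le (I J : Ideal A) (k : ℕ) :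
    bracketIdeal K (I ^ (k + 1)) J ≤ I ^ k * bracketIdeal K I J := by
  induction k with
  | zero => simp
  | succ k ih =>
    calc bracketIdeal K (I ^ (k + 1 + 1)) J
        = bracketIdeal K (I ^ (k + 1) * I) J := by rw [pow_succ]
      _ ≤ I ^ (k + 1) * bracketIdeal K I J ⊔ I * bracketIdeal K (I ^ (k + 1)) J :=
        bracketIdeal_mul_le _ _ _
      _ ≤ I ^ (k + 1) * bracketIdeal K I J :=
        sup_le le_rfl ((Ideal.mul_mono_right ih).trans_eq (by rw [← mul_assoc, ← pow_succ']))

theorem mul_mul_bracketIdeal_top_le (I J : Ideal A) :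
    I * J * bracketIdeal K ⊤ ⊤ ≤ bracketIdeal K I J := by
  have mul_bracket_mem {a b : A} (ha : a ∈ I) (hb : b ∈ J) (x y : A) :
      a * b * bracket (K := K) x y ∈ bracketIdeal K I J := by
    have expand : a * b * bracket (K := K) x y =
        bracket (K := K) (a * x) (b * y) - y * bracket (K := K) (a * x) b -
          x * bracket (K := K) a (b * y) + x * y * bracket (K := K) a b := by
      simp only [leibniz, leibniz_right]
      ring
    rw [expand]
    exact add_mem (sub_mem (sub_mem
      (bracket_mem_bracketIdeal (I.mul_mem_right x ha) (J.mul_mem_right y hb))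
      (Ideal.mul_mem_left _ y (bracket_mem_bracketIdeal (I.mul_mem_right x ha) hb)))
      (Ideal.mul_mem_left _ x (bracket_mem_bracketIdeal ha (J.mul_mem_right y hb))))
      (Ideal.mul_mem_left _ (x * y) (bracket_mem_bracketIdeal ha hb))
  refine Ideal.mul_le.2 fun r hr c hc => ?_
  suffices h : bracketIdeal K ⊤ ⊤ ≤
      Submodule.comap (LinearMap.mulLeft A r) (bracketIdeal K I J) from h hc
  refine bracketIdeal_le.2 fun x _ y _ => ?_
  rw [Submodule.mem_comap, LinearMap.mulLeft_apply]
  refine Submodule.mul_induction_on hr (fun a ha b hb => mul_bracket_mem ha hb x y) ?_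
  intro a b ha hb
  rw [add_mul]
  exact add_mem ha hb

theorem bracket_mem_of_mem_span {S : Set A} {N : Ideal A} {a b : A} (ha : a ∈ Ideal.span S)
    (hS : ∀ s ∈ S, bracket (K := K) s b ∈ N)
    (hN : Ideal.span S * bracketIdeal K ⊤ ⊤ ≤ N) : bracket (K := K) a b ∈ N := by
  induction ha using Submodule.span_induction with
  | mem s hs => exact hS s hs
  | zero => simp
  | add x y _ _ hx hy => simpa only [map_add, LinearMap.add_apply] using add_mem hx hy
  | smul r x hx h =>
    rw [smul_eq_mul, leibniz]
    exact add_mem (N.mul_mem_left r h)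
      (hN (Ideal.mul_mem_mul hx (bracket_mem_bracketIdeal trivial trivial)))

theorem bracketIdeal_span_span_le (S T : Set A) :
    bracketIdeal K (Ideal.span S) (Ideal.span T) ≤
      Ideal.span (Set.image2 (fun a b => bracket (K := K) a b) S T) ⊔
        (Ideal.span S ⊔ Ideal.span T) * bracketIdeal K ⊤ ⊤ := by
  refine bracketIdeal_le.2 fun a ha b hb => bracket_mem_of_mem_span ha (fun s hs => ?_)
    ((Ideal.mul_mono_left le_sup_left).trans le_sup_right)
  rw [bracket_skew]
  refine neg_mem (bracket_mem_of_mem_span hb (fun t ht => ?_)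
    ((Ideal.mul_mono_left le_sup_right).trans le_sup_right))
  rw [bracket_skew]
  exact neg_mem (Ideal.mem_sup_left (Ideal.subset_span ⟨s, hs, t, ht, rfl⟩))

theorem bracketIdeal_top_top_of_adjoin_eq_top {S : Set A} (hS : Algebra.adjoin K S = ⊤) :
    bracketIdeal K (⊤ : Ideal A) ⊤ =
      Ideal.span (Set.image2 (fun a b => bracket (K := K) a b) S S) := by
  refine le_antisymm (bracketIdeal_le.2 fun a _ b _ => ?_) (Ideal.span_le.2 ?_)
  · refine derivation_apply_mem_of_adjoin_eq_top (hamiltonian K a) hS (fun t ht => ?_) b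
    rw [hamiltonian_apply, bracket_skew]
    refine neg_mem (derivation_apply_mem_of_adjoin_eq_top (hamiltonian K t) hS (fun s hs => ?_) a)
    exact Ideal.subset_span ⟨t, ht, s, hs, rfl⟩
  · rintro _ ⟨s, -, t, -, rfl⟩
    exact bracket_mem_bracketIdeal trivial trivial

end BracketIdeal

section StronglySolvable

variable {K A : Type*} [CommRing K] [CommRing A] [Algebra K A] [PoissonAlgebra K A]

theorem pow_le_upperDerivedSeries (n : ℕ) :
    bracketIdeal K (⊤ : Ideal A) ⊤ ^ (2 ^ n - 1) ≤ upperDerivedSeries K A n := by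
  induction n with
  | zero => exact le_top
  | succ n ih =>
    rw [pow_two_pow_succ_sub_one]
    exact (Ideal.mul_mono_left (Ideal.mul_mono ih ih)).trans (mul_mul_bracketIdeal_top_le _ _)

theorem IsStronglySolvable.isNilpotent_bracketIdeal (h : IsStronglySolvable K A) :
    IsNilpotent (bracketIdeal K (⊤ : Ideal A) ⊤) := by
  obtain ⟨n, hn⟩ := h
  exact ⟨2 ^ n - 1, le_bot_iff.1 (hn ▸ pow_le_upperDerivedSeries n)⟩

theorem isStronglySolvable_of_le_sq {n : ℕ}
    (hn : upperDerivedSeries K A n ≤ bracketIdeal K ⊤ ⊤ ^ 2)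
    (hC : IsNilpotent (bracketIdeal K (⊤ : Ideal A) ⊤)) : IsStronglySolvable K A := by
  set C := bracketIdeal K (⊤ : Ideal A) ⊤
  have bracketIdeal_pow_self_le (k : ℕ) :
      bracketIdeal K (C ^ (k + 2)) (C ^ (k + 2)) ≤ C ^ (k + 3) :=
    calc bracketIdeal K (C ^ (k + 2)) (C ^ (k + 2))
        ≤ C ^ (k + 1) * bracketIdeal K C (C ^ (k + 2)) := bracketIdeal_pow_le _ _ _
      _ ≤ C ^ (k + 1) * (C ^ (k + 1) * bracketIdeal K C C) := by
        rw [bracketIdeal_comm C]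
        exact Ideal.mul_mono_right (bracketIdeal_pow_le _ _ _)
      _ ≤ C ^ (k + 1) * (C ^ (k + 1) * C) :=
        Ideal.mul_mono_right (Ideal.mul_mono_right (bracketIdeal_mono le_top le_top))
      _ ≤ C ^ (k + 3) := by
        rw [← pow_succ, ← pow_add]
        exact Ideal.pow_le_pow_right (by omega)
  have upperDerivedSeries_le (k : ℕ) : upperDerivedSeries K A (n + k) ≤ C ^ (k + 2) := by
    induction k with
    | zero => exact hn
    | succ k ih => exact (bracketIdeal_mono ih ih).trans (bracketIdeal_pow_self_le k)
  obtain ⟨m, hm⟩ := hC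
  refine ⟨n + m, le_bot_iff.1 ((upperDerivedSeries_le m).trans ?_)⟩
  rw [pow_add, hm, zero_mul, Ideal.zero_eq_bot]

theorem derivedSeries_le_upperDerivedSeries (n : ℕ) :
    derivedSeries K A n ≤ (upperDerivedSeries K A n).restrictScalars K := by
  induction n with
  | zero => exact le_top
  | succ n ih =>
    refine Submodule.span_le.2 ?_
    rintro _ ⟨a, ha, b, hb, rfl⟩
    exact bracket_mem_bracketIdeal (ih ha) (ih hb)

theorem IsStronglySolvable.isSolvable (h : IsStronglySolvable K A) : IsSolvable K A := by
  obtain ⟨n, hn⟩ := h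
  refine ⟨n, le_bot_iff.1 ((derivedSeries_le_upperDerivedSeries n).trans_eq ?_)⟩
  rw [hn, Submodule.restrictScalars_bot]

end StronglySolvable

section LieMap

variable {K L A : Type*} [CommRing K] [LieRing L] [LieAlgebra K L] [CommRing A] [Algebra K A]
  [PoissonAlgebra K A] {f : L →ₗ[K] A}

theorem map_lieDerivedSeries_le (hf : ∀ x y, bracket (K := K) (f x) (f y) = f ⁅x, y⁆) (n : ℕ) :
    (LieAlgebra.derivedSeries K L n).toSubmodule.map f ≤ derivedSeries K A n := by
  induction n with
  | zero => exact le_top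
  | succ n ih =>
    rw [LieAlgebra.derivedSeries_def, LieAlgebra.derivedSeriesOfIdeal_succ,
      LieSubmodule.lieIdeal_oper_eq_linear_span', Submodule.map_span_le]
    rintro _ ⟨y, hy, z, hz, rfl⟩
    rw [← hf]
    exact Submodule.subset_span ⟨f y, ih ⟨y, hy, rfl⟩, f z, ih ⟨z, hz, rfl⟩, rfl⟩

theorem IsSolvable.lieAlgebra_isSolvable (h : IsSolvable K A) (hf₀ : Function.Injective f)
    (hf : ∀ x y, bracket (K := K) (f x) (f y) = f ⁅x, y⁆) : LieAlgebra.IsSolvable L := by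
  obtain ⟨n, hn⟩ := h
  have hmap : (LieAlgebra.derivedSeries K L n).toSubmodule.map f = ⊥ :=
    le_bot_iff.1 (hn ▸ map_lieDerivedSeries_le hf n)
  refine LieAlgebra.IsSolvable.mk (R := K) (k := n) (LieSubmodule.toSubmodule_injective ?_)
  exact Submodule.map_injective_of_injective hf₀ (hmap.trans (Submodule.map_bot f).symm)

end LieMap

end PoissonAlgebra

theorem mul_mul_span_range_le_of_wronskian_mem {K A : Type*} [CommRing K] [CommRing A]
    [Algebra K A] (h2 : IsUnit (2 : K)) (D : Derivation K A A) {Λ Λ' : Submodule K A}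
    (hD : ∀ a ∈ Λ, ∀ b ∈ Λ, a * D b - b * D a ∈ Λ') {I : Ideal A}
    (hI : I.restrictScalars K ≤ Λ) :
    (I * I * Ideal.span (Set.range D)).restrictScalars K ≤ Λ' := by
  have mul_mul_mem (y : A) {a b : A} (ha : a ∈ I) (hb : b ∈ I) : a * b * D y ∈ Λ' := by
    have polarized : (2 : K) • (a * b * D y) =
        (a * D (b * y) - b * y * D a) + (b * D (a * y) - a * y * D b) := by
      simp only [Derivation.leibniz, smul_eq_mul, two_smul]
      ring
    rw [← Submodule.smul_mem_iff_of_isUnit _ h2, polarized]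
    exact add_mem (hD a (hI ha) _ (hI (I.mul_mem_right y hb)))
      (hD b (hI hb) _ (hI (I.mul_mem_right y ha)))
  have mul_mem (y : A) {c : A} (hc : c ∈ I * I) : c * D y ∈ Λ' := by
    refine Submodule.mul_induction_on hc (fun a ha b hb => mul_mul_mem y ha hb) ?_
    intro a b ha hb
    rw [add_mul]
    exact add_mem ha hb
  intro z hz
  obtain ⟨c, hc, rfl⟩ := (Submodule.mem_ideal_smul_span_iff_exists_sum _ _ z).1 hz
  exact sum_mem fun y _ => mul_mem y (hc y)

namespace PoissonAlgebra

section LeadingCoefficients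

variable {K A : Type*} [CommRing K] [CommRing A] [Algebra K A] [PoissonAlgebra K A] (x : A)

variable (K) in
/-- The leading coefficients, modulo `x`, of the multiples of `x` in `δₙ`: the elements `a` such
that `x * a' ∈ δₙ` for some `a' ≡ a` modulo `x`. -/
def leadingCoefficients (n : ℕ) : Submodule K A :=
  (derivedSeries K A n).comap (LinearMap.mulLeft K x) ⊔ (Ideal.span {x}).restrictScalars K

variable {x}

theorem mem_leadingCoefficients_iff {n : ℕ} {a : A} :
    a ∈ leadingCoefficients K x n ↔ ∃ c, x * (a + x * c) ∈ derivedSeries K A n := by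
  constructor
  · intro ha
    obtain ⟨a', ha', b, hb, rfl⟩ := Submodule.mem_sup.1 ha
    obtain ⟨c, rfl⟩ := Ideal.mem_span_singleton.1 hb
    exact ⟨-c, by simpa using ha'⟩
  · rintro ⟨c, hc⟩
    rw [← add_sub_cancel_right a (x * c)]
    exact sub_mem (Submodule.mem_sup_left hc)
      (Submodule.mem_sup_right (Ideal.mem_span_singleton.2 (dvd_mul_right x c)))

theorem wronskian_mem_leadingCoefficients {n : ℕ} {a b : A}
    (ha : a ∈ leadingCoefficients K x n) (hb : b ∈ leadingCoefficients K x n) :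
    a * hamiltonian K x b - b * hamiltonian K x a ∈ leadingCoefficients K x (n + 1) := by
  obtain ⟨c, hc⟩ := mem_leadingCoefficients_iff.1 ha
  obtain ⟨d, hd⟩ := mem_leadingCoefficients_iff.1 hb
  set a' := a + x * c with ha'
  set b' := b + x * d with hb'
  have bracket_eq : bracket (K := K) (x * a') (x * b') =
      x * (a' * hamiltonian K x b' - b' * hamiltonian K x a' + x * bracket (K := K) a' b') := by
    simp only [leibniz, leibniz_right, bracket_self, bracket_skew a' x, hamiltonian_apply]
    ring
  refine mem_leadingCoefficients_iff.2 ⟨a * hamiltonian K x d + c * hamiltonian K x b' -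
    b * hamiltonian K x c - d * hamiltonian K x a' + bracket (K := K) a' b',
    Submodule.subset_span ⟨x * a', hc, x * b', hd, ?_⟩⟩
  rw [bracket_eq]
  simp only [ha', hb', map_add, hamiltonian_apply, leibniz_right, bracket_self]
  ring

theorem pow_le_leadingCoefficients (h2 : IsUnit (2 : K)) (n : ℕ) :
    (Ideal.span (Set.range (hamiltonian K x)) ^ (2 ^ n - 1)).restrictScalars K ≤
      leadingCoefficients K x n := by
  induction n with
  | zero => exact fun a _ => Submodule.mem_sup_left trivial
  | succ n ih =>
    rw [pow_two_pow_succ_sub_one]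
    exact mul_mul_span_range_le_of_wronskian_mem h2 (hamiltonian K x)
      (fun a ha b hb => wronskian_mem_leadingCoefficients ha hb) ih

theorem sq_dvd_mul_of_mem_pow (h2 : IsUnit (2 : K)) {n : ℕ} (hn : derivedSeries K A n = ⊥) {a : A}
    (ha : a ∈ Ideal.span (Set.range (hamiltonian K x)) ^ (2 ^ n - 1)) : x ^ 2 ∣ x * a := by
  obtain ⟨c, hc⟩ := mem_leadingCoefficients_iff.1 (pow_le_leadingCoefficients h2 n ha)
  rw [hn, Submodule.mem_bot] at hc
  exact ⟨-c, by linear_combination hc⟩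

end LeadingCoefficients

end PoissonAlgebra

theorem range_le_range_add_of_ker_sup_eq_top {R W U : Type*} [Semiring R] [AddCommMonoid W]
    [Module R W] [AddCommMonoid U] [Module R U] {f g : W →ₗ[R] U} {Q : Submodule R W}
    (hf : f.ker ⊔ Q = ⊤) (hg : Q ≤ g.ker) : f.range ≤ (f + g).range := by
  rintro _ ⟨w, rfl⟩
  obtain ⟨k, hk, q, hq, rfl⟩ := Submodule.mem_sup.1 (hf ▸ Submodule.mem_top : w ∈ f.ker ⊔ Q)
  exact ⟨q, by simp [LinearMap.mem_ker.1 hk, LinearMap.mem_ker.1 (hg hq)]⟩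

section FiniteRank

variable {K V W U : Type*} [Field K] [AddCommGroup V] [Module K V] [AddCommGroup W] [Module K W]
  [AddCommGroup U] [Module K U]

theorem exists_mem_notMem_span_range_of_lt_rank {n : ℕ} (u : Fin n → V) {M : Submodule K V}
    (hM : n < Module.rank K M) : ∃ w ∈ M, w ∉ Submodule.span K (Set.range u) := by
  by_contra! h
  have := Module.Finite.span_of_finite K (Set.finite_range u)
  refine hM.not_ge ((Submodule.rank_mono h).trans ?_)
  rw [← Module.finrank_eq_rank, Nat.cast_le]
  exact (finrank_range_le_card u).trans_eq (Fintype.card_fin n)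

theorem exists_linearIndependent_finCons_of_lt_rank {x : V} (hx : x ≠ 0) {M : Submodule K V}
    {n : ℕ} (hn : n < Module.rank K M) :
    ∃ v : Fin n → V, (∀ i, v i ∈ M) ∧ LinearIndependent K (Fin.cons x v : Fin (n + 1) → V) := by
  induction n with
  | zero =>
    exact ⟨Fin.elim0, fun i => i.elim0, linearIndependent_finCons.2
      ⟨linearIndependent_empty_type, by simpa using hx⟩⟩
  | succ n ih =>
    obtain ⟨v, hvM, hv⟩ := ih ((Nat.cast_lt.2 n.lt_succ_self).trans hn)
    obtain ⟨w, hw, hwv⟩ := exists_mem_notMem_span_range_of_lt_rank (Fin.cons x v) hn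
    refine ⟨Fin.snoc v w, Fin.lastCases (by simpa using hw) (by simpa using hvM), ?_⟩
    rw [Fin.cons_snoc_eq_snoc_cons]
    exact linearIndependent_finSnoc.2 ⟨hv, hwv⟩

variable {B : V →ₗ[K] W →ₗ[K] U} {n : ℕ}

theorem fg_range_of_rank_le {f : W →ₗ[K] U} (hf : f.rank ≤ n) : f.range.FG :=
  Module.Finite.iff_fg.1 (Module.rank_lt_aleph0_iff.1 (hf.trans_lt Cardinal.natCast_lt_aleph0))

theorem exists_forall_finrank_range_le (hB : ∀ v, (B v).rank ≤ n) :
    ∃ v₀, ∀ v, Module.finrank K (B v).range ≤ Module.finrank K (B v₀).range := by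
  have bddAbove : BddAbove (Set.range fun v => Module.finrank K (B v).range) :=
    ⟨n, by rintro _ ⟨v, rfl⟩; exact Module.finrank_le_of_rank_le (hB v)⟩
  obtain ⟨v₀, hv₀⟩ := Nat.sSup_mem (Set.range_nonempty _) bddAbove
  exact ⟨v₀, fun v => (le_csSup bddAbove ⟨v, rfl⟩).trans_eq hv₀.symm⟩

theorem exists_coFG_forall_range_le (hB : ∀ v, (B v).rank ≤ n)
    (hB' : ∀ w, (B.flip w).HasFiniteRange) :
    ∃ v₀, ∃ N : Submodule K V, N.CoFG ∧ ∀ v ∈ N, (B v).range ≤ (B v₀).range := by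
  obtain ⟨v₀, hv₀⟩ := exists_forall_finrank_range_le hB
  obtain ⟨Q, hQ⟩ := Submodule.exists_isCompl (B v₀).ker
  have coFG_ker : (B v₀).ker.CoFG :=
    Submodule.range_fg_iff_ker_cofg.1 (fg_range_of_rank_le (hB v₀))
  obtain ⟨T, rfl⟩ := coFG_ker.fg_of_isCompl hQ
  refine ⟨v₀, sInf ((fun t => (B.flip t).ker) '' T),
    Submodule.CoFG.sInf_of_finite (T.finite_toSet.image _) ?_, fun v hv => ?_⟩
  · rintro _ ⟨t, -, rfl⟩
    exact Submodule.range_fg_iff_ker_cofg.1 (hB' t)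
  have span_le_ker : Submodule.span K T ≤ (B v).ker :=
    Submodule.span_le.2 fun t ht => (Submodule.mem_sInf.1 hv) _ ⟨t, ht, rfl⟩
  -- As `B v` vanishes on a complement of `ker (B v₀)`, adding it to `B v₀` keeps the range.
  have range_add_eq : (B v₀).range = (B (v₀ + v)).range := by
    have := Module.Finite.iff_fg.2 (fg_range_of_rank_le (hB (v₀ + v)))
    refine Submodule.eq_of_le_of_finrank_le ?_ (hv₀ (v₀ + v))
    rw [map_add]
    exact range_le_range_add_of_ker_sup_eq_top hQ.sup_eq_top span_le_ker
  rintro _ ⟨w, rfl⟩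
  have : B (v₀ + v) w - B v₀ w ∈ (B v₀).range :=
    sub_mem (range_add_eq ▸ LinearMap.mem_range_self _ w) (LinearMap.mem_range_self _ w)
  simpa using this

theorem fg_iSup_range_of_rank_le (hB : ∀ v, (B v).rank ≤ n)
    (hB' : ∀ w, (B.flip w).HasFiniteRange) : (⨆ v, (B v).range).FG := by
  obtain ⟨v₀, N, hN, hv₀⟩ := exists_coFG_forall_range_le hB hB'
  obtain ⟨Q, hQ⟩ := Submodule.exists_isCompl N
  obtain ⟨T, rfl⟩ := hN.fg_of_isCompl hQ
  have fg_range (v : V) : (B v).range.FG := fg_range_of_rank_le (hB v)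
  refine ((fg_range v₀).sup (Submodule.fg_biSup T _ fun t _ => fg_range t)).of_le ?_
  refine iSup_le fun v => ?_
  rintro _ ⟨w, rfl⟩
  obtain ⟨c, hc, q, hq, rfl⟩ := Submodule.mem_sup.1 (hQ.sup_eq_top ▸ Submodule.mem_top : v ∈ _)
  rw [map_add, LinearMap.add_apply]
  refine Submodule.add_mem_sup (hv₀ c hc (LinearMap.mem_range_self _ w)) ?_
  suffices h : Submodule.span K T ≤
    Submodule.comap (B.flip w) (⨆ t ∈ T, (B t).range) from h hq
  refine Submodule.span_le.2 fun t ht => ?_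
  exact Submodule.mem_iSup_of_mem t (Submodule.mem_iSup_of_mem ht (LinearMap.mem_range_self _ w))

end FiniteRank

theorem fg_lie_top_top_of_rank_ad_le {K L : Type*} [Field K] [LieRing L] [LieAlgebra K L]
    {n : ℕ} (h : ∀ x : L, (LieAlgebra.ad K L x : L →ₗ[K] L).rank ≤ n) :
    (⁅(⊤ : LieIdeal K L), (⊤ : LieIdeal K L)⁆ : LieIdeal K L).toSubmodule.FG := by
  let B : L →ₗ[K] L →ₗ[K] L := (LieAlgebra.ad K L : L →ₗ[K] Module.End K L)
  have flip_eq (x : L) : B.flip x = -B x := by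
    ext y
    simp [B]
  refine (fg_iSup_range_of_rank_le (B := B) h fun x => ?_).of_le ?_
  · rw [flip_eq]
    exact .neg (fg_range_of_rank_le (h x))
  · rw [LieSubmodule.lieIdeal_oper_eq_linear_span', Submodule.span_le]
    rintro _ ⟨x, -, y, -, rfl⟩
    exact Submodule.mem_iSup_of_mem x ⟨y, rfl⟩

theorem prod_X_notMem_span_sq {ι R : Type*} [Fintype ι] [CommSemiring R] [Nontrivial R] :
    ∏ i, (MvPolynomial.X i : MvPolynomial ι R) ∉
      Ideal.span (Set.range fun i => (MvPolynomial.X i : MvPolynomial ι R) ^ 2) := by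
  classical
  have span_eq : Set.range (fun i => (MvPolynomial.X i : MvPolynomial ι R) ^ 2) =
      (fun s => MvPolynomial.monomial s 1) '' Set.range fun i => Finsupp.single i 2 := by
    simp only [← Set.range_comp, Function.comp_def, MvPolynomial.X_pow_eq_monomial]
  have prod_eq : ∏ i, (MvPolynomial.X i : MvPolynomial ι R) =
      MvPolynomial.monomial (∑ i, Finsupp.single i 1) 1 := by
    simp [MvPolynomial.monomial_sum_one, MvPolynomial.X]
  rw [span_eq, prod_eq, MvPolynomial.mem_ideal_span_monomial_image]
  intro h
  obtain ⟨_, ⟨i, rfl⟩, hi⟩ := h (∑ i, Finsupp.single i 1) (by simp)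
  simpa [Finsupp.single_apply] using hi i

namespace TruncatedSymmetricAlgebra

open PoissonAlgebra

section Basic

variable (K : Type*) {L : Type*} [CommRing K] [LieRing L] [LieAlgebra K L] (p : ℕ)

/-- The canonical map `L → s(L)`. -/
noncomputable def of : L →ₗ[K] TruncatedSymmetricAlgebra K L p :=
  (Ideal.Quotient.mkₐ K (truncationIdeal K L p)).toLinearMap ∘ₗ SymmetricAlgebra.ι K L

theorem of_pow (v : L) : of K p v ^ p = 0 := by
  change Ideal.Quotient.mk (truncationIdeal K L p) (SymmetricAlgebra.ι K L v) ^ p = 0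
  rw [← map_pow]
  exact Ideal.Quotient.eq_zero_iff_mem.2 (Ideal.subset_span ⟨v, rfl⟩)

theorem adjoin_range_of :
    Algebra.adjoin K (Set.range (of K p : L → TruncatedSymmetricAlgebra K L p)) = ⊤ := by
  refine eq_top_iff.2 fun a _ => ?_
  obtain ⟨a, rfl⟩ := Ideal.Quotient.mk_surjective a
  induction a using SymmetricAlgebra.induction with
  | algebraMap r => exact Subalgebra.algebraMap_mem _ r
  | ι x => exact Algebra.subset_adjoin ⟨x, rfl⟩
  | mul a b ha hb => rw [map_mul]; exact mul_mem (ha trivial) (hb trivial)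
  | add a b ha hb => rw [map_add]; exact add_mem (ha trivial) (hb trivial)

theorem bracket_of_of [CharP K p] (x y : L) :
    PoissonAlgebra.bracket (K := K) (of K p x) (of K p y) = of K p ⁅x, y⁆ :=
  congrArg (Ideal.Quotient.mk (truncationIdeal K L p)) (SymmetricAlgebra.poissonBracket_ι_ι x y)

variable {K p} {B : Type*} [CommRing B] [Algebra K B] (f : L →ₗ[K] B) (hf : ∀ x, f x ^ p = 0)

/-- The universal property of `s(L)`: a linear map whose values have vanishing `p`-th power
extends to `s(L)`. -/
noncomputable def lift : TruncatedSymmetricAlgebra K L p →ₐ[K] B :=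
  Ideal.Quotient.liftₐ (truncationIdeal K L p) (SymmetricAlgebra.lift f) <| by
    suffices h : truncationIdeal K L p ≤ RingHom.ker (SymmetricAlgebra.lift f) from
      fun a ha => h ha
    refine Ideal.span_le.2 ?_
    rintro _ ⟨v, rfl⟩
    simp [hf]

theorem lift_of (x : L) : lift f hf (of K p x) = f x :=
  SymmetricAlgebra.lift_ι_apply (f := f) x

end Basic

section IdealOf

variable {K L : Type*} [CommRing K] [LieRing L] [LieAlgebra K L] (p : ℕ)

/-- The ideal of `s(L)` generated by a submodule of `L`. -/
def idealOf (M : Submodule K L) : Ideal (TruncatedSymmetricAlgebra K L p) :=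
  Ideal.span (of K p '' M)

theorem of_mem_idealOf {M : Submodule K L} {x : L} (hx : x ∈ M) : of K p x ∈ idealOf p M :=
  Ideal.subset_span ⟨x, hx, rfl⟩

theorem idealOf_mono {M N : Submodule K L} (h : M ≤ N) : idealOf p M ≤ idealOf p N :=
  Ideal.span_mono (Set.image_mono h)

theorem idealOf_bot : idealOf p (⊥ : Submodule K L) = ⊥ := by
  simp [idealOf]

theorem idealOf_span (S : Set L) :
    idealOf p (Submodule.span K S) = Ideal.span (of K p '' S) := by
  rw [idealOf, ← Submodule.map_coe, Submodule.map_span, Ideal.span, Submodule.span_span_of_tower]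

theorem isNilpotent_idealOf {M : Submodule K L} (hM : M.FG) : IsNilpotent (idealOf p M) := by
  obtain ⟨T, rfl⟩ := hM
  rw [idealOf_span, Ideal.FG.isNilpotent_iff_le_nilradical
    (Submodule.fg_span (T.finite_toSet.image _)), Ideal.span_le]
  rintro _ ⟨x, -, rfl⟩
  exact mem_nilradical.2 ⟨p, of_pow K p x⟩

variable [CharP K p]

theorem span_image2_bracket_of (I J : LieIdeal K L) :
    Ideal.span (Set.image2 (fun a b => PoissonAlgebra.bracket (K := K) a b)
        (of K p '' I) (of K p '' J)) = idealOf p ⁅I, J⁆.toSubmodule := by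
  rw [LieSubmodule.lieIdeal_oper_eq_linear_span', idealOf_span]
  congr 1
  change _ = of K p '' Set.image2 (fun x y => ⁅x, y⁆) (I : Set L) (J : Set L)
  rw [Set.image2_image_left, Set.image2_image_right, Set.image_image2]
  simp only [bracket_of_of]

variable (K L) in
theorem bracketIdeal_top_top :
    bracketIdeal K (⊤ : Ideal (TruncatedSymmetricAlgebra K L p)) ⊤ =
      idealOf p (⁅(⊤ : LieIdeal K L), (⊤ : LieIdeal K L)⁆ : LieIdeal K L).toSubmodule := by
  rw [bracketIdeal_top_top_of_adjoin_eq_top (adjoin_range_of K p), ← span_image2_bracket_of]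
  simp

theorem bracketIdeal_idealOf_le (I J : LieIdeal K L) :
    bracketIdeal K (idealOf p I.toSubmodule) (idealOf p J.toSubmodule) ≤
      idealOf p ⁅I, J⁆.toSubmodule ⊔
        (idealOf p I.toSubmodule ⊔ idealOf p J.toSubmodule) * bracketIdeal K ⊤ ⊤ := by
  rw [← span_image2_bracket_of]
  exact bracketIdeal_span_span_le _ _

theorem upperDerivedSeries_succ_le (n : ℕ) :
    upperDerivedSeries K (TruncatedSymmetricAlgebra K L p) (n + 1) ≤
      idealOf p (LieAlgebra.derivedSeries K L (n + 1)).toSubmodule ⊔ bracketIdeal K ⊤ ⊤ ^ 2 := by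
  set C := bracketIdeal K (⊤ : Ideal (TruncatedSymmetricAlgebra K L p)) ⊤ with hC
  induction n with
  | zero =>
    refine le_sup_of_le_left ?_
    exact (bracketIdeal_top_top K L p).le
  | succ n ih =>
    set M := LieAlgebra.derivedSeries K L (n + 1)
    have idealOf_le : idealOf p M.toSubmodule ≤ C := by
      rw [hC, bracketIdeal_top_top]
      exact idealOf_mono p (LieAlgebra.derivedSeriesOfIdeal_antitone ⊤ (Nat.le_add_left 1 n))
    have derivedSeries_eq : ⁅M, M⁆ = LieAlgebra.derivedSeries K L (n + 1 + 1) :=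
      (LieAlgebra.derivedSeriesOfIdeal_succ ..).symm
    rw [← derivedSeries_eq]
    calc upperDerivedSeries K (TruncatedSymmetricAlgebra K L p) (n + 1 + 1)
        ≤ bracketIdeal K (idealOf p M.toSubmodule ⊔ C ^ 2) (idealOf p M.toSubmodule ⊔ C ^ 2) :=
          bracketIdeal_mono ih ih
      _ ≤ bracketIdeal K (idealOf p M.toSubmodule) (idealOf p M.toSubmodule) ⊔
            bracketIdeal K (C ^ 2) ⊤ := bracketIdeal_sup_self_le _ _
      _ ≤ (idealOf p ⁅M, M⁆.toSubmodule ⊔ C * C) ⊔ C ^ 1 * bracketIdeal K C ⊤ := by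
          gcongr
          · refine (bracketIdeal_idealOf_le p M M).trans ?_
            rw [sup_idem]
            exact sup_le_sup_left (Ideal.mul_mono_left idealOf_le) _
          · exact bracketIdeal_pow_le C ⊤ 1
      _ ≤ idealOf p ⁅M, M⁆.toSubmodule ⊔ C ^ 2 := by
          rw [pow_one, sup_assoc, sq]
          exact sup_le_sup_left (sup_le le_rfl
            (Ideal.mul_mono_right (bracketIdeal_mono le_top le_rfl))) _

end IdealOf

section Field

variable {K L : Type*} [Field K] [LieRing L] [LieAlgebra K L] (p : ℕ) [Fact p.Prime] [CharP K p]

theorem exists_algHom_of_eq_mk_X {ι : Type*} {v : ι → L} (hv : LinearIndependent K v) :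
    ∃ φ : TruncatedSymmetricAlgebra K L p →ₐ[K] MvPolynomial ι K ⧸
        Ideal.span (Set.range fun i => (MvPolynomial.X i : MvPolynomial ι K) ^ 2),
      ∀ i, φ (of K p (v i)) = Ideal.Quotient.mk _ (MvPolynomial.X i) := by
  set I := Ideal.span (Set.range fun i => (MvPolynomial.X i : MvPolynomial ι K) ^ 2)
  obtain ⟨g, hg⟩ := LinearMap.exists_leftInverse_of_injective
    (Finsupp.linearCombination K v) (LinearMap.ker_eq_bot.2 hv)
  have hgv (i : ι) : g (v i) = Finsupp.single i 1 := by simpa using congr($hg (Finsupp.single i 1))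
  let f : L →ₗ[K] MvPolynomial ι K ⧸ I := (Ideal.Quotient.mkₐ K I).toLinearMap ∘ₗ
    Finsupp.linearCombination K (MvPolynomial.X : ι → MvPolynomial ι K) ∘ₗ g
  have hf (x : L) : f x ^ p = 0 := by
    change Ideal.Quotient.mk I (Finsupp.linearCombination K MvPolynomial.X (g x)) ^ p = 0
    rw [← map_pow, Ideal.Quotient.eq_zero_iff_mem, Finsupp.linearCombination_apply, Finsupp.sum,
      sum_pow_char]
    refine sum_mem fun i _ => ?_
    rw [smul_pow]
    exact Submodule.smul_of_tower_mem _ _ (I.mem_of_dvd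
      (pow_dvd_pow _ (Fact.out : p.Prime).two_le) (Ideal.subset_span ⟨i, rfl⟩))
  exact ⟨lift f hf, fun i => by simp [lift_of, f, hgv]⟩

theorem prod_of_notMem_span_sq {ι : Type*} [Fintype ι] {v : ι → L} (hv : LinearIndependent K v) :
    ∏ i, of K p (v i) ∉ Ideal.span (Set.range fun i => of K p (v i) ^ 2) := by
  obtain ⟨φ, hφ⟩ := exists_algHom_of_eq_mk_X p hv
  intro h
  refine prod_X_notMem_span_sq (ι := ι) (R := K) (Ideal.Quotient.eq_zero_iff_mem.1 ?_)
  have map_eq_bot : (Ideal.span (Set.range fun i => of K p (v i) ^ 2)).map φ = ⊥ := by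
    rw [Ideal.map_span, Ideal.span_eq_bot]
    rintro _ ⟨_, ⟨i, rfl⟩, rfl⟩
    rw [map_pow, hφ, ← map_pow, Ideal.Quotient.eq_zero_iff_mem]
    exact Ideal.subset_span ⟨i, rfl⟩
  have := Ideal.mem_map_of_mem φ h
  rwa [map_eq_bot, Ideal.mem_bot, map_prod, Finset.prod_congr rfl fun i _ => hφ i,
    ← map_prod] at this

theorem of_injective : Function.Injective (of K p : L → TruncatedSymmetricAlgebra K L p) := by
  refine (injective_iff_map_eq_zero _).2 fun x hx => by_contra fun hx₀ => ?_
  have hv : LinearIndependent K fun _ : Fin 1 => x := linearIndependent_unique_iff.2 hx₀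
  exact prod_of_notMem_span_sq p hv (by simp [hx])

theorem rank_le_of_forall_sq_dvd {x : L} (hx : x ≠ 0) {M : Submodule K L} {n : ℕ}
    (h : ∀ a ∈ idealOf p M ^ n, of K p x ^ 2 ∣ of K p x * a) : Module.rank K M ≤ n := by
  by_contra! hn
  obtain ⟨v, hvM, hv⟩ := exists_linearIndependent_finCons_of_lt_rank hx hn
  have prod_mem : ∏ i, of K p (v i) ∈ idealOf p M ^ n := by
    simpa using Ideal.prod_mem_prod (s := Finset.univ) fun i _ => of_mem_idealOf p (hvM i)
  refine prod_of_notMem_span_sq p hv ?_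
  rw [Fin.prod_univ_succ]
  exact Ideal.mem_of_dvd _ (h _ prod_mem) (Ideal.subset_span ⟨0, rfl⟩)

theorem isNilpotent_idealOf_iff {M : Submodule K L} : IsNilpotent (idealOf p M) ↔ M.FG := by
  refine ⟨fun ⟨n, hn⟩ => ?_, isNilpotent_idealOf p⟩
  rcases eq_or_ne M ⊥ with rfl | hM
  · exact Submodule.fg_bot
  obtain ⟨x, -, hx⟩ := M.exists_mem_ne_zero_of_ne_bot hM
  have rank_le : Module.rank K M ≤ n := rank_le_of_forall_sq_dvd p hx fun a ha => by
    rw [hn] at ha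
    simp [(Submodule.mem_bot _).1 ha]
  exact Module.Finite.iff_fg.1 (Module.rank_lt_aleph0_iff.1
    (rank_le.trans_lt Cardinal.natCast_lt_aleph0))

theorem lieAlgebra_isSolvable_of_isSolvable
    (h : PoissonAlgebra.IsSolvable K (TruncatedSymmetricAlgebra K L p)) : LieAlgebra.IsSolvable L :=
  h.lieAlgebra_isSolvable (of_injective p) (bracket_of_of K p)

theorem isStronglySolvable_iff :
    IsStronglySolvable K (TruncatedSymmetricAlgebra K L p) ↔
      LieAlgebra.IsSolvable L ∧
        FiniteDimensional K (⁅(⊤ : LieIdeal K L), (⊤ : LieIdeal K L)⁆ : LieIdeal K L) := by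
  have isNilpotent_iff :
      IsNilpotent (bracketIdeal K (⊤ : Ideal (TruncatedSymmetricAlgebra K L p)) ⊤) ↔
        FiniteDimensional K (⁅(⊤ : LieIdeal K L), (⊤ : LieIdeal K L)⁆ : LieIdeal K L) := by
    rw [bracketIdeal_top_top, isNilpotent_idealOf_iff, ← Module.Finite.iff_fg]
    rfl
  refine ⟨fun h => ⟨lieAlgebra_isSolvable_of_isSolvable p h.isSolvable,
    isNilpotent_iff.1 h.isNilpotent_bracketIdeal⟩, fun ⟨hL, hfin⟩ => ?_⟩
  obtain ⟨n, hn⟩ := (LieAlgebra.isSolvable_iff K L).1 hL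
  refine isStronglySolvable_of_le_sq (n := n + 1) ?_ (isNilpotent_iff.2 hfin)
  refine (upperDerivedSeries_succ_le p n).trans (sup_le ?_ le_rfl)
  have derivedSeries_eq_bot : LieAlgebra.derivedSeries K L (n + 1) = ⊥ :=
    le_bot_iff.1 (hn ▸ LieAlgebra.derivedSeriesOfIdeal_antitone ⊤ n.le_succ)
  rw [derivedSeries_eq_bot, LieSubmodule.bot_toSubmodule, idealOf_bot]
  exact bot_le

theorem rank_ad_le (hp : 3 ≤ p) {n : ℕ}
    (hn : PoissonAlgebra.derivedSeries K (TruncatedSymmetricAlgebra K L p) n = ⊥) (x : L) :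
    (LieAlgebra.ad K L x : L →ₗ[K] L).rank ≤ (2 ^ n - 1 : ℕ) := by
  rcases eq_or_ne x 0 with rfl | hx
  · simp
  have isUnit_two : IsUnit (2 : K) :=
    .mk0 2 (Ring.two_ne_zero (by have := ringChar.eq K p; omega))
  have idealOf_le : idealOf p (LieAlgebra.ad K L x : L →ₗ[K] L).range ≤
      Ideal.span (Set.range (hamiltonian K (of K p x))) := by
    refine Ideal.span_le.2 ?_
    rintro _ ⟨_, ⟨y, rfl⟩, rfl⟩
    exact Ideal.subset_span ⟨of K p y, bracket_of_of K p x y⟩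
  exact rank_le_of_forall_sq_dvd p hx fun a ha =>
    sq_dvd_mul_of_mem_pow isUnit_two hn (Ideal.pow_right_mono idealOf_le _ ha)

theorem finiteDimensional_lie_top_top_of_isSolvable (hp : 3 ≤ p)
    (h : PoissonAlgebra.IsSolvable K (TruncatedSymmetricAlgebra K L p)) :
    FiniteDimensional K (⁅(⊤ : LieIdeal K L), (⊤ : LieIdeal K L)⁆ : LieIdeal K L) := by
  obtain ⟨n, hn⟩ := h
  exact Module.Finite.iff_fg.2 (fg_lie_top_top_of_rank_ad_le (rank_ad_le p hp hn))

end Field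

end TruncatedSymmetricAlgebra

theorem mainTheorem3 {K L : Type*} [Field K] [LieRing L] [LieAlgebra K L]
    (p : ℕ) [Fact p.Prime] [CharP K p] :
    (3 ≤ p →
      List.TFAE
        [PoissonAlgebra.IsStronglySolvable K (TruncatedSymmetricAlgebra K L p),
          PoissonAlgebra.IsSolvable K (TruncatedSymmetricAlgebra K L p),
          LieAlgebra.IsSolvable L ∧
            FiniteDimensional K (⁅(⊤ : LieIdeal K L), (⊤ : LieIdeal K L)⁆ : LieIdeal K L)]) ∧
    (p = 2 →
      (PoissonAlgebra.IsStronglySolvable K (TruncatedSymmetricAlgebra K L p) ↔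
        LieAlgebra.IsSolvable L ∧
          FiniteDimensional K (⁅(⊤ : LieIdeal K L), (⊤ : LieIdeal K L)⁆ : LieIdeal K L))) := by
  have isStronglySolvable_iff :=
    TruncatedSymmetricAlgebra.isStronglySolvable_iff (K := K) (L := L) p
  refine ⟨fun hp => ?_, fun _ => isStronglySolvable_iff⟩
  tfae_have 1 → 2 := PoissonAlgebra.IsStronglySolvable.isSolvable
  tfae_have 2 → 3 := fun h =>
    ⟨TruncatedSymmetricAlgebra.lieAlgebra_isSolvable_of_isSolvable p h,
      TruncatedSymmetricAlgebra.finiteDimensional_lie_top_top_of_isSolvable p hp h⟩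
  tfae_have 3 → 1 := isStronglySolvable_iff.2
  tfae_finish
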